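/- Let $n \ge 0$ be an integer and let $\mathcal{S} = \mathcal{S}(\mathbb{R}^n)$ be the space of complex-valued Schwartz functions on $\mathbb{R}^n$ with its usual Fréchet topology. Let $\mathcal{S}_0'$ be the space of continuous $\mathbb{R}$-linear functionals $\mathcal{S} \to \mathbb{R}$, equipped with the strong topology, i.e. the topology of uniform convergence on the bounded subsets of $\mathcal{S}$, and regarded as a topological group under addition. Let $\widehat{\mathcal{S}}$ be the dual group of the topological group $(\mathcal{S},+)$, i.e. the group of all continuous group homomorphisms $\mathcal{S} \to \mathbb{T} = \{z \in \mathbb{C} : |z| = 1\}$ under pointwise multiplication, equipped with the compact-open topology. Then the map $$\mathcal{S}_0' \to \widehat{\mathcal{S}}, \qquad u \mapsto \lambda_u, \qquad \lambda_u(\varphi) := e^{i\langle u, \varphi\rangle} \quad (\varphi \in \mathcal{S}),$$ is well defined and is an isomorphism of topological groups, i.e. a group isomorphism and a homeomorphism. In particular, $\widehat{\mathcal{S}}$ and $\mathcal{S}_0'$ are isomorphic as topological groups. -/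

import Mathlib

open scoped SchwartzMap

/-- The Schwartz space of rapidly decreasing smooth functions `ℝⁿ → ℂ`, with its Fréchet topology. -/
abbrev SchwartzSp (n : ℕ) : Type := 𝓢(EuclideanSpace ℝ (Fin n), ℂ)

/-- The space of continuous `ℝ`-linear functionals `𝓢(ℝⁿ) → ℝ`. Mathlib's topology on it is the
strong one: uniform convergence on the (von Neumann) bounded subsets of the Schwartz space. -/
abbrev RealSchwartzDual (n : ℕ) : Type := SchwartzSp n →L[ℝ] ℝ

/-- The dual group of `(𝓢(ℝⁿ), +)`: continuous homomorphisms to the circle group, with pointwise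
multiplication and the compact-open topology. -/
abbrev SchwartzCharGroup (n : ℕ) : Type := PontryaginDual (Multiplicative (SchwartzSp n))

open Filter Topology Set
open scoped ContDiff

/-! A locally convex space is simply connected, so a character lifts through the covering
`Circle.exp` to a continuous real function; the lift is additive, hence real-linear, and `u ↦ exp (i
u)` is bijective. It is continuous because compact sets are bounded. Its inverse is continuous when
bounded sets have compact closure, so the analytic core is that the Schwartz space is Montel
(`SchwartzMap.instMontelSpace`), an Arzelà–Ascoli argument. -/

theorem abs_lt_of_forall_exp_mul_mem_centeredArc {r δ : ℝ} (hδ : 0 < δ) (hδπ : δ < Real.pi)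
    (h : ∀ t ∈ Icc (0 : ℝ) 1, Circle.exp (t * r) ∈ Circle.centeredArc δ) : |r| < δ := by
  by_contra! hr
  have hr0 : 0 < |r| := hδ.trans_le hr
  have hmem := h (δ / |r|) ⟨by positivity, (div_le_one hr0).2 hr⟩
  rw [Circle.mem_centeredArc hδπ.le] at hmem
  have habs : |δ / |r| * r| = δ := by
    rw [abs_mul, abs_div, abs_abs, abs_of_pos hδ, div_mul_cancel₀ _ hr0.ne']
  have hle := abs_le.1 habs.le
  rw [Circle.arg_exp (by linarith) (by linarith), habs] at hmem
  exact lt_irrefl _ hmem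

section Characters

variable {V : Type*} [AddCommGroup V] [Module ℝ V] [TopologicalSpace V]

/-- The character `x ↦ exp (i u x)` attached to a continuous real linear functional `u`. -/
noncomputable def ContinuousLinearMap.expCharacter (u : V →L[ℝ] ℝ) :
    PontryaginDual (Multiplicative V) :=
  (⟨⟨⟨fun x => Circle.exp (u x.toAdd), by simp⟩, fun x y => by simp [Circle.exp_add]⟩,
    Circle.exp.continuous.comp (u.continuous.comp continuous_toAdd)⟩ :
    Multiplicative V →ₜ* Circle)

theorem ContinuousLinearMap.expCharacter_apply (u : V →L[ℝ] ℝ) (x : Multiplicative V) :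
    u.expCharacter x = Circle.exp (u x.toAdd) := rfl

variable (V) in
/-- The group homomorphism sending a functional `u` to the character `x ↦ exp (i u x)`. -/
noncomputable def expCharacterHom :
    Multiplicative (V →L[ℝ] ℝ) →* PontryaginDual (Multiplicative V) where
  toFun u := u.toAdd.expCharacter
  map_one' := PontryaginDual.ext fun x => by
    simp [ContinuousLinearMap.expCharacter_apply]
  map_mul' u v := PontryaginDual.ext fun x => by
    change Circle.exp (u.toAdd x.toAdd + v.toAdd x.toAdd) = _
    rw [Circle.exp_add]; rfl

theorem expCharacterHom_apply (u : Multiplicative (V →L[ℝ] ℝ)) (x : Multiplicative V) :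
    expCharacterHom V u x = Circle.exp (u.toAdd x.toAdd) := rfl

/-- A continuous real function on a connected space whose exponential is trivial is constant. -/
theorem eq_of_forall_circleExp_eq_one {X : Type*} [TopologicalSpace X] [PreconnectedSpace X]
    {f : X → ℝ} (hf : Continuous f) (h : ∀ x, Circle.exp (f x) = 1) (x y : X) : f x = f y := by
  have key := Circle.isCoveringMap_exp.eq_of_comp_eq (A := X) (g₁ := f) (g₂ := fun _ => f y)
    hf continuous_const (by ext z; simp [h]) y rfl
  exact congrFun key x

variable [IsTopologicalAddGroup V] [ContinuousSMul ℝ V]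

theorem expCharacterHom_injective : Function.Injective (expCharacterHom V) := by
  rw [injective_iff_map_eq_one]
  intro u hu
  have h (x : V) : Circle.exp (u.toAdd x) = 1 := DFunLike.congr_fun hu (Multiplicative.ofAdd x)
  apply Multiplicative.toAdd.injective
  ext x
  simpa using eq_of_forall_circleExp_eq_one u.toAdd.continuous h x 0

theorem expCharacterHom_surjective [LocallyConvexSpace ℝ V] :
    Function.Surjective (expCharacterHom V) := by
  intro χ
  let f : C(V, Circle) :=
    ⟨fun x => χ (Multiplicative.ofAdd x), (map_continuous χ).comp continuous_ofAdd⟩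
  have hf0 : f 0 = 1 := map_one χ
  have hfadd (x y : V) : f (x + y) = f x * f y := map_mul χ _ _
  obtain ⟨F, ⟨hF0, hF⟩, -⟩ := Circle.isCoveringMap_exp.existsUnique_continuousMap_lifts f
    (0 : V) (0 : ℝ) (by simp [hf0])
  have hF' (x : V) : Circle.exp (F x) = f x := congrFun hF x
  have hadd (x y : V) : F (x + y) = F x + F y := by
    -- The additivity defect takes values in `2πℤ` on the connected space `V × V`, so it is
    -- constant.
    have := eq_of_forall_circleExp_eq_one (X := V × V)
      (f := fun p => F (p.1 + p.2) - F p.1 - F p.2) (by fun_prop)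
      (fun p => by simp [Circle.exp_sub, hF', hfadd]) (x, y) (0, 0)
    simp [hF0] at this
    linarith
  let A : V →+ ℝ := ⟨⟨F, hF0⟩, hadd⟩
  refine ⟨Multiplicative.ofAdd (A.toRealLinearMap F.continuous), PontryaginDual.ext fun x => ?_⟩
  exact hF' x.toAdd

theorem continuous_expCharacterHom : Continuous (expCharacterHom V) := by
  refine continuous_of_continuousAt_one _ ?_
  rw [ContinuousAt, map_one]
  refine (ContinuousMonoidHom.isInducing_toContinuousMap
    (Multiplicative V) Circle).tendsto_nhds_iff.2 ?_
  rw [ContinuousMap.tendsto_nhds_compactOpen]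
  intro K hK U hU hKU
  rcases K.eq_empty_or_nonempty with rfl | ⟨x₀, hx₀⟩
  · exact .of_forall fun _ => mapsTo_empty _ _
  have h1 : (1 : Circle) ∈ U := hKU hx₀
  have hK' : Bornology.IsVonNBounded ℝ (Multiplicative.toAdd '' K) :=
    (hK.image continuous_toAdd).isVonNBounded ℝ
  have hU' : Circle.exp ⁻¹' U ∈ 𝓝 (0 : ℝ) :=
    Circle.exp.continuous.continuousAt (hU.mem_nhds (by simpa using h1))
  have := ContinuousLinearMap.eventually_nhds_zero_mapsTo (σ := RingHom.id ℝ) hK' hU'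
  have ht : Tendsto Multiplicative.toAdd (𝓝 (1 : Multiplicative (V →L[ℝ] ℝ))) (𝓝 0) :=
    continuous_toAdd.tendsto 1
  filter_upwards [ht.eventually this] with u hu x hx
  exact hu (mem_image_of_mem _ hx)

theorem exists_continuousMulEquiv_expCharacterHom [LocallyConvexSpace ℝ V] [T1Space V]
    [MontelSpace ℝ V] :
    ∃ Λ : Multiplicative (V →L[ℝ] ℝ) ≃ₜ* PontryaginDual (Multiplicative V),
      ∀ u, Λ u = expCharacterHom V u := by
  let e := MulEquiv.ofBijective (expCharacterHom V)
    ⟨expCharacterHom_injective, expCharacterHom_surjective⟩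
  refine ⟨⟨e, continuous_expCharacterHom, ?_⟩, fun u => rfl⟩
  refine continuous_of_continuousAt_one e.symm ?_
  rw [ContinuousAt, map_one]
  suffices h : Tendsto (fun χ => (e.symm χ).toAdd) (𝓝 1) (𝓝 (0 : V →L[ℝ] ℝ)) from
    (continuous_ofAdd.tendsto (0 : V →L[ℝ] ℝ)).comp h
  rw [(ContinuousLinearMap.hasBasis_nhds_zero_of_basis
    (Metric.nhds_basis_ball (x := (0 : ℝ)))).tendsto_right_iff]
  rintro ⟨B, ε⟩ ⟨hB, hε⟩
  obtain ⟨δ, hδ, hδε, hδπ⟩ : ∃ δ : ℝ, 0 < δ ∧ δ ≤ ε ∧ δ < Real.pi :=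
    ⟨min ε 1, by positivity, min_le_left _ _,
      (min_le_right _ _).trans_lt (by linarith [Real.pi_gt_three])⟩
  have hcB : IsCompact (closure B) :=
    MontelSpace.isCompact_of_isClosed_of_isVonNBounded ℝ isClosed_closure hB.closure
  -- Including the segments from `0` prevents values of `u` near nonzero multiples of `2π` from
  -- passing as small.
  let K : Set (Multiplicative V) :=
    (fun p : ℝ × V => Multiplicative.ofAdd (p.1 • p.2)) '' (Icc 0 1 ×ˢ closure B)
  have hK : IsCompact K :=
    (isCompact_Icc.prod hcB).image (continuous_ofAdd.comp continuous_smul)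
  have hmaps : ∀ᶠ χ : PontryaginDual (Multiplicative V) in 𝓝 1,
      MapsTo (fun x => χ x) K (Circle.centeredArc δ) := by
    have := (ContinuousMonoidHom.isInducing_toContinuousMap (Multiplicative V)
      Circle).continuous.tendsto (1 : PontryaginDual (Multiplicative V))
    refine (ContinuousMap.tendsto_nhds_compactOpen.1 this) K hK _
      (Circle.isOpen_centeredArc δ) fun x _ => ?_
    change (1 : Circle) ∈ _
    rw [Circle.mem_centeredArc hδπ.le]
    simpa using hδ
  filter_upwards [hmaps] with χ hχ x hx
  obtain ⟨u, rfl⟩ := e.surjective χ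
  rw [e.symm_apply_apply, mem_ball_zero_iff, Real.norm_eq_abs]
  refine (abs_lt_of_forall_exp_mul_mem_centeredArc hδ hδπ fun t ht => ?_).trans_le hδε
  have := hχ (mem_image_of_mem _ (mk_mem_prod ht (subset_closure hx)))
  rw [← smul_eq_mul, ← ContinuousLinearMap.map_smul]
  exact this

end Characters

/-- A uniformly Lipschitz family converging pointwise converges uniformly on compact sets. -/
theorem tendstoUniformlyOn_of_lipschitzWith {ι X Y : Type*} [PseudoMetricSpace X]
    [PseudoMetricSpace Y] {l : Filter ι} {F : ι → X → Y} {g : X → Y} {C : NNReal}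
    (hF : ∀ i, LipschitzWith C (F i)) (hg : LipschitzWith C g)
    (h : ∀ x, Tendsto (fun i => F i x) l (𝓝 (g x))) {K : Set X} (hK : IsCompact K) :
    TendstoUniformlyOn F g l K := by
  rw [Metric.tendstoUniformlyOn_iff]
  intro ε hε
  obtain ⟨δ, hδ, hCδ⟩ : ∃ δ : ℝ, 0 < δ ∧ C * δ < ε / 3 := by
    refine ⟨ε / 3 / (C + 1), by positivity, ?_⟩
    rw [← mul_div_assoc, div_lt_iff₀ (by positivity)]
    nlinarith [C.coe_nonneg]
  obtain ⟨t, -, ht, hcov⟩ := hK.finite_cover_balls hδ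
  have hev : ∀ᶠ i in l, ∀ y ∈ t, dist (F i y) (g y) < ε / 3 :=
    (ht.eventually_all).2 fun y _ => (h y).eventually (Metric.ball_mem_nhds _ (by positivity))
  filter_upwards [hev] with i hi x hx
  obtain ⟨y, hy, hxy⟩ := mem_iUnion₂.1 (hcov hx)
  have h1 : dist (g x) (g y) < ε / 3 :=
    ((hg.dist_le_mul x y).trans (by gcongr; exact (Metric.mem_ball.1 hxy).le)).trans_lt hCδ
  have h2 : dist (F i x) (F i y) < ε / 3 :=
    (((hF i).dist_le_mul x y).trans (by gcongr; exact (Metric.mem_ball.1 hxy).le)).trans_lt hCδ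
  have h3 := hi y hy
  have h4 := dist_triangle4 (g x) (g y) (F i y) (F i x)
  rw [dist_comm (g y), dist_comm (F i y) (F i x)] at h4
  linarith

namespace SchwartzMap

variable {E F : Type*} [NormedAddCommGroup E] [NormedSpace ℝ E]
  [NormedAddCommGroup F] [NormedSpace ℝ F]

theorem lipschitzWith_iteratedFDeriv {f : 𝓢(E, F)} {m : ℕ} {C : NNReal}
    (h : SchwartzMap.seminorm ℝ 0 (m + 1) f ≤ C) : LipschitzWith C (iteratedFDeriv ℝ m f) := by
  refine lipschitzWith_of_nnnorm_fderiv_le (𝕜 := ℝ)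
    ((f.smooth ⊤).differentiable_iteratedFDeriv (by exact_mod_cast WithTop.coe_lt_top m)) fun x => ?_
  rw [← NNReal.coe_le_coe, coe_nnnorm, norm_fderiv_iteratedFDeriv]
  exact (norm_iteratedFDeriv_le_seminorm ℝ f (m + 1) x).trans h

/-- If the Schwartz functions in a family satisfy uniform seminorm bounds and all their derivatives
converge pointwise, then they converge in the Schwartz space. -/
theorem exists_tendsto_of_tendsto_iteratedFDeriv [ProperSpace E] {ι : Type*} {l : Filter ι} [l.NeBot]
    {f : ι → 𝓢(E, F)} {C : ℕ → ℕ → NNReal}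
    (hC : ∀ k m i, SchwartzMap.seminorm ℝ k m (f i) ≤ C k m)
    {p : E → FormalMultilinearSeries ℝ E F}
    (hp : ∀ x m, Tendsto (fun i => iteratedFDeriv ℝ m (f i) x) l (𝓝 (p x m))) :
    ∃ g, Tendsto f l (𝓝 g) := by
  have hlip (m : ℕ) (i : ι) : LipschitzWith (C 0 (m + 1)) (iteratedFDeriv ℝ m (f i)) :=
    lipschitzWith_iteratedFDeriv (hC _ _ i)
  have hplip (m : ℕ) : LipschitzWith (C 0 (m + 1)) (fun x => p x m) :=
    LipschitzWith.of_dist_le_mul fun x y =>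
      le_of_tendsto ((hp x m).dist (hp y m)) (.of_forall fun i => (hlip m i).dist_le_mul x y)
  have hunif (m : ℕ) {K : Set E} (hK : IsCompact K) :
      TendstoUniformlyOn (fun i => iteratedFDeriv ℝ m (f i)) (fun x => p x m) l K :=
    tendstoUniformlyOn_of_lipschitzWith (hlip m) (hplip m) (fun x => hp x m) hK
  have hdecay (k m : ℕ) (x : E) : ‖x‖ ^ k * ‖p x m‖ ≤ C k m :=
    le_of_tendsto ((hp x m).norm.const_mul _)
      (.of_forall fun i => (le_seminorm ℝ k m (f i) x).trans (hC k m i))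
  have htaylor : HasFTaylorSeriesUpTo ∞ (fun x => (p x 0).curry0) p := by
    refine (hasFTaylorSeriesUpTo_top_iff' le_rfl).2 ⟨fun x => rfl, fun m x => ?_⟩
    -- Locally uniform convergence of the next derivatives lets differentiation pass to the limit.
    refine hasFDerivAt_of_tendstoUniformlyOn (𝕜 := ℝ) (l := l) Metric.isOpen_ball
      (f := fun i => iteratedFDeriv ℝ m (f i))
      (f' := fun i y => (iteratedFDeriv ℝ (m + 1) (f i) y).curryLeft)
      (g' := fun y => (p y (m + 1)).curryLeft)
      ?_ (fun i y _ => ?_) (fun y _ => hp y m) (Metric.mem_ball_self (x := x) one_pos)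
    · have := (hunif (m + 1) (isCompact_closedBall x 1)).mono Metric.ball_subset_closedBall
      exact (continuousMultilinearCurryLeftEquiv ℝ (fun _ : Fin (m + 1) => E)
        F).isometry.uniformContinuous.comp_tendstoUniformlyOn this
    · have := (((f i).smooth ⊤).ftaylorSeries).fderiv m
        (by exact_mod_cast WithTop.coe_lt_top m) y
      exact this
  let g : 𝓢(E, F) :=
    { toFun := fun x => (p x 0).curry0
      smooth' := htaylor.contDiff
      decay' := fun k m => ⟨C k m, fun x => by
        rw [← htaylor.eq_iteratedFDeriv (by exact_mod_cast le_top) x]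
        exact hdecay k m x⟩ }
  have hg (m : ℕ) (x : E) : iteratedFDeriv ℝ m g x = p x m :=
    (htaylor.eq_iteratedFDeriv (by exact_mod_cast le_top) x).symm
  refine ⟨g, ((schwartz_withSeminorms ℝ E F).tendsto_nhds f g).2 ?_⟩
  rintro ⟨k, m⟩ ε hε
  change ∀ᶠ i in l, SchwartzMap.seminorm ℝ k m (f i - g) < ε
  have hsub (i : ι) (x : E) : iteratedFDeriv ℝ m (f i - g : 𝓢(E, F)) x =
      iteratedFDeriv ℝ m (f i) x - p x m := by
    rw [← hg m x]
    exact iteratedFDeriv_sub_apply (((f i).smooth m).contDiffAt) ((g.smooth m).contDiffAt)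
  -- Beyond radius `R` one spare power of decay gives the bound `ε / 2`; inside, uniform convergence
  -- does.
  obtain ⟨R, hR, hCR⟩ : ∃ R : ℝ, 0 < R ∧ 2 * C (k + 1) m ≤ ε / 2 * R :=
    ⟨2 * C (k + 1) m / (ε / 2) + 1, by positivity, by field_simp; nlinarith⟩
  have hev := (Metric.tendstoUniformlyOn_iff.1 (hunif m (isCompact_closedBall (0 : E) R)))
    (ε / 2 / R ^ k) (by positivity)
  filter_upwards [hev] with i hi
  refine (seminorm_le_bound ℝ k m _ (half_pos hε).le fun x => ?_).trans_lt (half_lt_self hε)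
  rw [hsub]
  rcases le_or_gt ‖x‖ R with hx | hx
  · have h1 := hi x (by simpa using hx)
    rw [dist_eq_norm, norm_sub_rev] at h1
    calc _ ≤ R ^ k * (ε / 2 / R ^ k) := by gcongr
      _ = ε / 2 := by field_simp
  · have h1 := (le_seminorm ℝ (k + 1) m (f i) x).trans (hC _ _ i)
    have h2 := hdecay (k + 1) m x
    have h3 : ‖x‖ ^ (k + 1) * ‖iteratedFDeriv ℝ m (f i) x - p x m‖ ≤ ε / 2 * R := by
      calc _ ≤ ‖x‖ ^ (k + 1) * (‖iteratedFDeriv ℝ m (f i) x‖ + ‖p x m‖) := by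
            gcongr; exact norm_sub_le _ _
        _ ≤ ε / 2 * R := by rw [mul_add]; linarith
    refine le_of_mul_le_mul_right ?_ hR
    refine le_trans ?_ h3
    rw [pow_succ, mul_right_comm]
    gcongr

/-- Seminorm bounds confine each derivative at each point to a compact ball in finite dimensions, so
every ultrafilter on a bounded set converges pointwise with all derivatives, hence in the Schwartz
topology. -/
instance instMontelSpace [FiniteDimensional ℝ E] [FiniteDimensional ℝ F] :
    MontelSpace ℝ 𝓢(E, F) where
  heine_borel s hs hb := by
    have : ProperSpace E := FiniteDimensional.proper_real E
    rw [(schwartz_withSeminorms ℝ E F).isVonNBounded_iff_seminorm_bounded] at hb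
    choose r hr0 hr using hb
    refine isCompact_iff_ultrafilter_le_nhds'.2 fun U hU => ?_
    let W : Ultrafilter s := U.comap Subtype.val_injective (by simpa using hU)
    have hWU : Tendsto ((↑) : s → 𝓢(E, F)) W U := tendsto_comap
    have hW : map ((↑) : s → 𝓢(E, F)) W = U := by
      change map _ (comap _ _) = _
      exact map_comap_of_mem (by simpa using hU)
    have hlim (x : E) (m : ℕ) : ∃ q : E [×m]→L[ℝ] F,
        Tendsto (fun f : s => iteratedFDeriv ℝ m (f : 𝓢(E, F)) x) W (𝓝 q) := by
      have : FiniteDimensional ℝ (E [×m]→L[ℝ] F) :=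
        Module.Finite.of_injective
          (ContinuousMultilinearMap.toMultilinearMapLinear :
            (E [×m]→L[ℝ] F) →ₗ[ℝ] MultilinearMap ℝ (fun _ : Fin m => E) F)
          fun _ _ h => ContinuousMultilinearMap.toMultilinearMap_injective h
      have : ProperSpace (E [×m]→L[ℝ] F) := FiniteDimensional.proper_real _
      obtain ⟨q, -, hq⟩ := (isCompact_closedBall (0 : E [×m]→L[ℝ] F)
        (r (0, m))).ultrafilter_le_nhds (W.map fun f : s => iteratedFDeriv ℝ m (f : 𝓢(E, F)) x)
        (by
          rw [le_principal_iff]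
          refine Ultrafilter.mem_map.2 (univ_mem' fun f => ?_)
          simpa using (norm_iteratedFDeriv_le_seminorm ℝ (f : 𝓢(E, F)) m x).trans
            (hr (0, m) f f.2).le)
      exact ⟨q, hq⟩
    choose p hp using hlim
    obtain ⟨g, hg⟩ := exists_tendsto_of_tendsto_iteratedFDeriv (l := (W : Filter s))
      (f := fun f : s => (f : 𝓢(E, F))) (C := fun k m => ⟨r (k, m), (hr0 (k, m)).le⟩)
      (fun k m f => (hr (k, m) f f.2).le) (p := p) hp
    have hgU : (U : Filter 𝓢(E, F)) ≤ 𝓝 g := hW ▸ hg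
    exact ⟨g, hs.mem_of_tendsto (f := id) (b := (U : Filter 𝓢(E, F))) hgU hU, hgU⟩

end SchwartzMap

theorem mainTheorem8 (n : ℕ) :
    ∃ Λ : Multiplicative (RealSchwartzDual n) ≃ₜ* SchwartzCharGroup n,
      ∀ (u : RealSchwartzDual n) (φ : SchwartzSp n),
        ((Λ (Multiplicative.ofAdd u) (Multiplicative.ofAdd φ) : Circle) : ℂ) =
          Complex.exp (Complex.I * ((u φ : ℝ) : ℂ)) := by
  obtain ⟨Λ, hΛ⟩ := exists_continuousMulEquiv_expCharacterHom (V := SchwartzSp n)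
  refine ⟨Λ, fun u φ => ?_⟩
  rw [hΛ, expCharacterHom_apply, Circle.coe_exp, mul_comm]
  rfl
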